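/- Let $S^1,S^2$ be finite sets, $Q=S^1\cap S^2$, and assume that $Q$, $S^1\setminus Q$ and $S^2\setminus Q$ are nonempty. The $Q$-sequence induced by a (finite or infinite) sequence is the sequence of its terms lying in $Q$, in order of appearance. A trajectory is a pair $s=(s^1,s^2)$, where $s^i$ is a finite or infinite sequence of elements of $S^i$, such that $s^1$ and $s^2$ induce the same $Q$-sequence; it is finite if both components are finite. Let $\Omega$ be the set of trajectories with both components infinite. For a finite trajectory $s$, let $\uparrow s\subseteq\Omega$ be the set of $\omega\in\Omega$ whose components extend $s^1$ and $s^2$ respectively, and equip $\Omega$ with the $\sigma$-algebra generated by the sets $\uparrow s$. For $\alpha=(x,z)\in S^1\times S^2$ and a finite trajectory $s$, let $\gamma_\alpha(s)$ be the pair of last states of $x\cdot s^1$ and $z\cdot s^2$. Concatenation $s\cdot\omega$ is componentwise; for a probability measure $\mathbf P$ on $\Omega$ and a finite trajectory $s$ with $\mathbf P(\uparrow s)>0$, the probabilistic future $\mathbf P_s$ is the image of $\mathbf P(\,\cdot\mid\uparrow s)$ under the inverse of the bijection $\Omega\to\uparrow s$, $\omega\mapsto s\cdot\omega$. An elementary trajectory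 is a finite trajectory whose $Q$-sequence has exactly one term, this term being the last state of both components; let $\mathcal E$ be the set of elementary trajectories, and let $\gamma(\sigma)$ denote the pair of last states of $\sigma\in\mathcal E$. Let two Markov chains on $S^1$ and $S^2$ be given whose transition matrices have only positive entries, and let $M^i_x$ be the law of $(X^i_1,X^i_2,\dots)$ for the $i$-th chain started at $X^i_0=x$. Let $\tau^i=\inf\{n>0: X^i_n\in Q\}$ and $\Delta=\{\tau^1<\infty,\ \tau^2<\infty,\ X^1_{\tau^1}=X^2_{\tau^2}\}$; then $M^1_x\otimes M^2_z(\Delta)>0$ for all $(x,z)\in S^1\times S^2$. Let $U_{(x,z)}$ be the law on $\mathcal E$ of $(X^1_1\cdots X^1_{\tau^1},\,X^2_1\cdots X^2_{\tau^2})$ under $M^1_x\otimes M^2_z(\,\cdot\mid\Delta)$. Put $X_0=\{(x,z)\in S^1\times S^2:\ (x\in Q\text{ and }z\in Q)\Rightarrow x=z\}$ and, for $\alpha\in X_0$, let $\mathbf P_\alpha$ be the law on $\Omega$ of the infinite concatenation $\sigma_1\cdot\sigma_2\cdots$, where $(\sigma_n)_{n\ge1}$ is the Markov chain on $\mathcal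 E$ with initial law $U_\alpha$ and transition kernel $K(\sigma,\sigma')=U_{\gamma(\sigma)}(\sigma')$. Then the family $(\mathbf P_\alpha)_{\alpha\in X_0}$ (the synchronization of the two chains) is a closed Markov two-components process; that is: 1. each $\mathbf P_\alpha$, $\alpha\in X_0$, is a probability measure on $\Omega$, and $\gamma_\alpha(s)\in X_0$ for every $\alpha\in X_0$ and every finite trajectory $s$ with $\mathbf P_\alpha(\uparrow s)>0$; 2. for every $\alpha\in X_0$ and every finite trajectory $s$ with $\mathbf P_\alpha(\uparrow s)>0$, $(\mathbf P_\alpha)_s=\mathbf P_{\gamma_\alpha(s)}$; 3. for every $\alpha\in X_0$, $\mathbf P_\alpha$-almost every $\omega\in\Omega$ has an infinite $Q$-sequence. -/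

import Mathlib

open MeasureTheory ProbabilityTheory

noncomputable section

namespace TwoComp

/-! ### Sequences and the `Q`-sequences they induce -/

section Sequences

variable {V : Type*} [DecidableEq V]

/-- The prefix of length `n` of an infinite sequence. -/
def pre {A : Type*} (x : ℕ → A) (n : ℕ) : List A := List.ofFn fun i : Fin n => x i

/-- The list `l` is a prefix of the infinite sequence `x`. -/
def IsPre {A : Type*} (l : List A) (x : ℕ → A) : Prop := ∀ i (h : i < l.length), l[i] = x i

/-- The `Q`-sequence induced by a finite sequence of states. -/
def qList (Q : Finset V) {S : Finset V} (l : List S) : List V :=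
  (l.map Subtype.val).filter (· ∈ Q)

/-- `v` is the term of index `n` (starting from `0`) of the `Q`-sequence, finite or infinite,
induced by the infinite sequence `x`. -/
def IsQTerm (Q : Finset V) {S : Finset V} (x : ℕ → S) (n : ℕ) (v : V) : Prop :=
  ∃ k, (qList Q (pre x k))[n]? = some v

/-- Concatenation of a finite sequence and an infinite one. -/
def appendSeq {A : Type*} (l : List A) (x : ℕ → A) (k : ℕ) : A :=
  if h : k < l.length then l[k] else x (k - l.length)

/-- The concatenation of the first `n` lists of a sequence of lists. -/
def flat {A : Type*} (l : ℕ → List A) : ℕ → List A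
  | 0 => []
  | n + 1 => flat l n ++ l n

theorem le_length_flat {A : Type*} (l : ℕ → List A) (hl : ∀ n, l n ≠ []) (n : ℕ) :
    n ≤ (flat l n).length := by
  induction n with
  | zero => simp
  | succ n ih =>
    have := List.length_pos_iff.2 (hl n)
    simp only [flat, List.length_append]
    omega

/-- The infinite concatenation `l 0 · l 1 · l 2 · …` of nonempty lists. -/
def infConcat {A : Type*} (l : ℕ → List A) (hl : ∀ n, l n ≠ []) (k : ℕ) : A :=
  (flat l (k + 1))[k]'(le_length_flat l hl (k + 1))

theorem qList_append (Q : Finset V) {S : Finset V} (l m : List S) :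
    qList Q (l ++ m) = qList Q l ++ qList Q m := by
  simp [qList]

theorem qList_prefix (Q : Finset V) {S : Finset V} {l m : List S} (h : l <+: m) :
    qList Q l <+: qList Q m := by
  obtain ⟨t, rfl⟩ := h
  rw [qList_append]
  exact List.prefix_append _ _

theorem getElem?_of_prefix {A : Type*} {l m : List A} (h : l <+: m) {n : ℕ} {v : A}
    (hv : l[n]? = some v) : m[n]? = some v := by
  obtain ⟨t, rfl⟩ := h
  rw [List.getElem?_append_left]
  · exact hv
  · exact (List.getElem?_eq_some_iff.1 hv).1

theorem pre_eq_take {A : Type*} {l : List A} {x : ℕ → A} (h : IsPre l x) {n : ℕ}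
    (hn : n ≤ l.length) : pre x n = l.take n := by
  apply List.ext_getElem
  · simp [pre, hn]
  · intro i h1 h2
    simp only [pre, List.getElem_ofFn, List.getElem_take]
    exact (h i _).symm

theorem isPre_flat {A : Type*} (l : ℕ → List A) (hl : ∀ n, l n ≠ []) (N : ℕ) :
    IsPre (flat l N) (infConcat l hl) := by
  have mono : ∀ m k, flat l m <+: flat l (m + k) := by
    intro m k
    induction k with
    | zero => exact List.prefix_refl _
    | succ k ih => exact ih.trans (List.prefix_append _ _)
  intro i h
  rw [infConcat]
  rcases le_total N (i + 1) with h1 | h1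
  · obtain ⟨k, hk⟩ := Nat.exists_eq_add_of_le h1
    have := mono N k
    rw [← hk] at this
    exact this.getElem h
  · obtain ⟨k, hk⟩ := Nat.exists_eq_add_of_le h1
    have := mono (i + 1) k
    rw [← hk] at this
    exact (this.getElem (le_length_flat l hl (i + 1))).symm

theorem isQTerm_infConcat (Q : Finset V) {S : Finset V} (l : ℕ → List S)
    (hl : ∀ n, l n ≠ []) (n : ℕ) (v : V) :
    IsQTerm Q (infConcat l hl) n v ↔ ∃ N, (qList Q (flat l N))[n]? = some v := by
  constructor
  · rintro ⟨k, hk⟩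
    refine ⟨k, getElem?_of_prefix (qList_prefix Q ?_) hk⟩
    rw [pre_eq_take (isPre_flat l hl k) (le_length_flat l hl k)]
    exact List.take_prefix _ _
  · rintro ⟨N, hN⟩
    refine ⟨(flat l N).length, ?_⟩
    rw [pre_eq_take (isPre_flat l hl N) le_rfl, List.take_length]
    exact hN

theorem qList_flat_congr (Q : Finset V) {S T : Finset V} (l : ℕ → List S) (m : ℕ → List T)
    (h : ∀ n, qList Q (l n) = qList Q (m n)) (N : ℕ) :
    qList Q (flat l N) = qList Q (flat m N) := by
  induction N with
  | zero => simp [flat, qList]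
  | succ N ih => simp only [flat, qList_append, ih, h]

theorem pre_appendSeq {A : Type*} (l : List A) (x : ℕ → A) (k : ℕ) :
    pre (appendSeq l x) (l.length + k) = l ++ pre x k := by
  apply List.ext_getElem
  · simp [pre]
  · intro i h1 h2
    simp only [pre, List.getElem_ofFn, appendSeq, List.getElem_append]

theorem pre_prefix {A : Type*} (x : ℕ → A) {m n : ℕ} (h : m ≤ n) : pre x m <+: pre x n := by
  have : IsPre (pre x n) x := fun i hi => by simp [pre]
  rw [pre_eq_take this (by simpa [pre] using h)]
  exact List.take_prefix _ _

theorem isQTerm_appendSeq (Q : Finset V) {S : Finset V} (l : List S) (x : ℕ → S)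
    (n : ℕ) (v : V) :
    IsQTerm Q (appendSeq l x) n v ↔
      (qList Q l)[n]? = some v ∨
        ((qList Q l).length ≤ n ∧ IsQTerm Q x (n - (qList Q l).length) v) := by
  have key : IsQTerm Q (appendSeq l x) n v ↔
      ∃ k, (qList Q l ++ qList Q (pre x k))[n]? = some v := by
    constructor
    · rintro ⟨k, hk⟩
      refine ⟨k, ?_⟩
      rw [← qList_append, ← pre_appendSeq]
      exact getElem?_of_prefix (qList_prefix Q (pre_prefix _ (by omega))) hk
    · rintro ⟨k, hk⟩
      refine ⟨l.length + k, ?_⟩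
      rw [pre_appendSeq, qList_append]
      exact hk
  rw [key]
  rcases lt_or_ge n (qList Q l).length with h | h
  · simp only [List.getElem?_append_left h, exists_const]
    constructor
    · exact Or.inl
    · rintro (h' | h')
      · exact h'
      · omega
  · simp only [List.getElem?_append_right h, IsQTerm, h, true_and]
    constructor
    · exact Or.inr
    · rintro (h' | h')
      · have := (List.getElem?_eq_some_iff.1 h').1
        omega
      · exact h'

end Sequences

/-! ### Trajectories of a distributed system `(S₁, S₂)` -/

section Trajectories

variable {V : Type*} [DecidableEq V] (S₁ S₂ : Finset V)

/-- Finite trajectories: pairs of finite local trajectories inducing the same `Q`-sequence,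
where `Q = S₁ ∩ S₂`. -/
@[ext]
structure FinTraj where
  fst : List S₁
  snd : List S₂
  sync : qList (S₁ ∩ S₂) fst = qList (S₁ ∩ S₂) snd

/-- The space `Ω` of trajectories both components of which are infinite: pairs of infinite local
trajectories inducing the same (finite or infinite) `Q`-sequence. -/
@[ext]
structure Omega where
  fst : ℕ → S₁
  snd : ℕ → S₂
  sync : ∀ n v, IsQTerm (S₁ ∩ S₂) fst n v ↔ IsQTerm (S₁ ∩ S₂) snd n v

/-- Elementary trajectories: finite trajectories with a unique synchronization, occurring at
their end. -/
@[ext]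
structure Elem where
  traj : FinTraj S₁ S₂
  elem : ∃ v, qList (S₁ ∩ S₂) traj.fst = [v] ∧
    (traj.fst.map Subtype.val).getLast? = some v ∧ (traj.snd.map Subtype.val).getLast? = some v

variable {S₁ S₂}

/-- The elementary cylinder `↑s`. -/
def cyl (s : FinTraj S₁ S₂) : Set (Omega S₁ S₂) :=
  {ω | IsPre s.fst ω.fst ∧ IsPre s.snd ω.snd}

/-- The σ-algebra on `Ω` generated by the elementary cylinders. -/
instance : MeasurableSpace (Omega S₁ S₂) :=
  MeasurableSpace.generateFrom (Set.range (cyl (S₁ := S₁) (S₂ := S₂)))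

/-- The global state reached by the finite trajectory `s` from the global state `α`: the last
states of `α.1 · s.fst` and of `α.2 · s.snd`. -/
def gam (α : S₁ × S₂) (s : FinTraj S₁ S₂) : S₁ × S₂ :=
  (s.fst.getLastD α.1, s.snd.getLastD α.2)

/-- The map `Φ_s : ω ↦ s · ω`. -/
def concat (s : FinTraj S₁ S₂) (ω : Omega S₁ S₂) : Omega S₁ S₂ :=
  ⟨appendSeq s.fst ω.fst, appendSeq s.snd ω.snd, fun n v => by
    rw [isQTerm_appendSeq, isQTerm_appendSeq, s.sync, ω.sync]⟩

/-- The probabilistic future of `s` with respect to `P`: the image under the inverse of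
`Φ_s : Ω → ↑s` of the conditional probability `P(· | ↑s)`. -/
def future (P : Measure (Omega S₁ S₂)) (s : FinTraj S₁ S₂) : Measure (Omega S₁ S₂) :=
  Measure.comap (concat s) (cond P (cyl s))

/-- The family `(P α)`, `α ∈ X₀`, is a probabilistic two-components process: each `P α` is a
probability measure on `Ω`, and every global state reachable from `α ∈ X₀` belongs to `X₀`. -/
structure IsProcess (X₀ : Set (S₁ × S₂)) (P : X₀ → Measure (Omega S₁ S₂)) : Prop where
  prob : ∀ α, IsProbabilityMeasure (P α)
  reach : ∀ (α : X₀) (s : FinTraj S₁ S₂), 0 < P α (cyl s) → gam α.1 s ∈ X₀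

/-- The Markov property: the probabilistic future of `s` with respect to `P α` is
`P (γ_α(s))`, for every finite trajectory `s` with `P α (↑s) > 0`. -/
structure IsMarkovProcess (X₀ : Set (S₁ × S₂)) (P : X₀ → Measure (Omega S₁ S₂)) : Prop
    extends IsProcess X₀ P where
  markov : ∀ (α : X₀) (s : FinTraj S₁ S₂) (h : 0 < P α (cyl s)),
    future (P α) s = P ⟨gam α.1 s, reach α s h⟩

/-- The process is closed: almost every trajectory synchronizes infinitely often. -/
def IsClosedProcess (X₀ : Set (S₁ × S₂)) (P : X₀ → Measure (Omega S₁ S₂)) : Prop :=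
  ∀ α, ∀ᵐ ω ∂(P α), ∀ n, ∃ v, IsQTerm (S₁ ∩ S₂) ω.fst n v

theorem Elem.fst_ne_nil (e : Elem S₁ S₂) : e.traj.fst ≠ [] := by
  obtain ⟨v, -, h, -⟩ := e.elem
  rintro h0
  simp [h0] at h

theorem Elem.snd_ne_nil (e : Elem S₁ S₂) : e.traj.snd ≠ [] := by
  obtain ⟨v, -, -, h⟩ := e.elem
  rintro h0
  simp [h0] at h

/-- The global state `γ(σ)` reached by an elementary trajectory (from any initial state). -/
def Elem.last (e : Elem S₁ S₂) : S₁ × S₂ :=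
  (e.traj.fst.getLast e.fst_ne_nil, e.traj.snd.getLast e.snd_ne_nil)

/-- The infinite concatenation of a sequence of elementary trajectories. -/
def elemConcat (σ : ℕ → Elem S₁ S₂) : Omega S₁ S₂ :=
  ⟨infConcat (fun n => (σ n).traj.fst) fun n => (σ n).fst_ne_nil,
    infConcat (fun n => (σ n).traj.snd) fun n => (σ n).snd_ne_nil, fun n v => by
    rw [isQTerm_infConcat, isQTerm_infConcat]
    simp only [qList_flat_congr _ _ _ fun n => (σ n).traj.sync]⟩

instance : MeasurableSpace (Elem S₁ S₂) := ⊤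

instance : DiscreteMeasurableSpace (Elem S₁ S₂) := ⟨fun _ => trivial⟩

instance : Countable (Elem S₁ S₂) := by
  refine Function.Injective.countable (f := fun e : Elem S₁ S₂ => (e.traj.fst, e.traj.snd)) ?_
  rintro ⟨⟨a, b, h⟩, h'⟩ ⟨⟨c, d, k⟩, k'⟩ hh
  simp only [Prod.mk.injEq] at hh
  obtain ⟨rfl, rfl⟩ := hh
  rfl

end Trajectories

/-! ### Markov chains -/

/-- The law on `ℕ → E` of the homogeneous Markov chain with initial law `μ` and transition
kernel `K`. -/
def chainLaw {E : Type*} [MeasurableSpace E] (μ : Measure E) (K : Kernel E E)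
    [IsMarkovKernel K] : Measure (ℕ → E) :=
  Kernel.trajMeasure (X := fun _ => E) μ fun n =>
    K.comap (fun h : (Π _ : Finset.Iic n, E) => h ⟨n, Finset.mem_Iic.2 le_rfl⟩)
      (measurable_pi_apply _)

instance {E : Type*} [MeasurableSpace E] (μ : Measure E) [IsProbabilityMeasure μ]
    (K : Kernel E E) [IsMarkovKernel K] : IsProbabilityMeasure (chainLaw μ K) := by
  unfold chainLaw
  infer_instance

theorem chainLaw_zero {E : Type*} [MeasurableSpace E] (μ : Measure E) (K : Kernel E E)
    [IsMarkovKernel K] : (chainLaw μ K).map (fun x => x 0) = μ := by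
  have hf : (fun x : ℕ → E => x 0) =
      (fun y : (Π _ : Finset.Iic 0, E) => y ⟨0, Finset.mem_Iic.2 le_rfl⟩) ∘
        Preorder.frestrictLe (π := fun _ => E) 0 := rfl
  rw [chainLaw, Kernel.trajMeasure, hf, ← Measure.map_map (by fun_prop) (by fun_prop),
    Measure.map_comp _ _ (by fun_prop), Kernel.traj_map_frestrictLe, Kernel.partialTraj_self,
    Measure.id_comp, Measure.map_map (by fun_prop) (by fun_prop)]
  exact Measure.map_id

section Chains

variable {V : Type*} [DecidableEq V]

/-- Local state sets are finite and carry the discrete σ-algebra. -/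
instance (S : Finset V) : MeasurableSpace S := ⊤

instance (S : Finset V) : DiscreteMeasurableSpace S := ⟨fun _ => trivial⟩

/-- A transition matrix on `S` all entries of which are positive. -/
structure PosTransition (S : Finset V) where
  mat : Matrix S S ℝ
  pos : ∀ x y, 0 < mat x y
  row_sum : ∀ x, ∑ y, mat x y = 1

variable {S : Finset V}

/-- The transition kernel associated with a transition matrix. -/
def PosTransition.kernel (P : PosTransition S) : Kernel S S :=
  Kernel.ofFunOfCountable fun x => ∑ y, ENNReal.ofReal (P.mat x y) • Measure.dirac y

theorem PosTransition.kernel_singleton (P : PosTransition S) (x y : S) :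
    P.kernel x {y} = ENNReal.ofReal (P.mat x y) := by
  simp [PosTransition.kernel, Kernel.ofFunOfCountable, Set.indicator_apply]

instance (P : PosTransition S) : IsMarkovKernel P.kernel := by
  refine ⟨fun x => ⟨?_⟩⟩
  simp only [PosTransition.kernel, Kernel.ofFunOfCountable, Kernel.coe_mk,
    Measure.coe_finsetSum, Measure.coe_smul, Finset.sum_apply, Pi.smul_apply, measure_univ,
    smul_eq_mul, mul_one]
  rw [← ENNReal.ofReal_sum_of_nonneg fun y _ => (P.pos x y).le, P.row_sum, ENNReal.ofReal_one]

/-- The law `M_x` on the space of infinite local trajectories: the law of `(X_1, X_2, …)` for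
the chain `(X_n)` with transition matrix `P` and `X_0 = x`. The entry of index `n` of a local
trajectory is thus `X_{n+1}`. -/
def PosTransition.law (P : PosTransition S) (x : S) : Measure (ℕ → S) :=
  chainLaw (P.kernel x) P.kernel

instance (P : PosTransition S) (x : S) : IsProbabilityMeasure (P.law x) := by
  unfold PosTransition.law
  infer_instance

/-- Index of the first entry in `Q` of a local trajectory (meaningful if there is one). -/
def firstHit (Q : Finset V) (x : ℕ → S) : ℕ := sInf {n | (x n : V) ∈ Q}

theorem firstHit_mem {Q : Finset V} {x : ℕ → S} (h : ∃ n, (x n : V) ∈ Q) :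
    (x (firstHit Q x) : V) ∈ Q := Nat.sInf_mem (s := {n | (x n : V) ∈ Q}) h

theorem measurable_firstHit (Q : Finset V) : Measurable (firstHit Q (S := S)) := by
  have hm : ∀ n, MeasurableSet {x : ℕ → S | (x n : V) ∈ Q} := fun n =>
    (measurable_pi_apply n : Measurable fun x : ℕ → S => x n)
      (MeasurableSet.of_discrete (s := {y : S | (y : V) ∈ Q}))
  refine measurable_to_countable' fun m => ?_
  have : firstHit Q ⁻¹' {m} =
      ({x : ℕ → S | (x m : V) ∈ Q} ∩ ⋂ j, ⋂ (_ : j < m), {x : ℕ → S | (x j : V) ∈ Q}ᶜ) ∪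
      ((⋂ j, {x : ℕ → S | (x j : V) ∈ Q}ᶜ) ∩ {_x : ℕ → S | m = 0}) := by
    ext x
    simp only [Set.mem_preimage, Set.mem_singleton_iff, Set.mem_union, Set.mem_inter_iff,
      Set.mem_ofPred_eq, Set.mem_iInter, Set.mem_compl_iff]
    constructor
    · rintro rfl
      by_cases h : ∃ n, (x n : V) ∈ Q
      · exact Or.inl ⟨firstHit_mem h, fun j hj => Nat.notMem_of_lt_sInf hj⟩
      · push Not at h
        refine Or.inr ⟨h, ?_⟩
        simp [firstHit, h]
    · rintro (⟨h1, h2⟩ | ⟨h1, rfl⟩)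
      · refine le_antisymm (Nat.sInf_le h1) ?_
        by_contra hlt
        exact h2 _ (not_le.1 hlt) (firstHit_mem ⟨m, h1⟩)
      · simp [firstHit, h1]
  rw [this]
  exact ((hm m).inter (MeasurableSet.iInter fun j => MeasurableSet.iInter fun _ =>
    (hm j).compl)).union ((MeasurableSet.iInter fun j => (hm j).compl).inter
      (MeasurableSet.const _))

/-- The finite sequence of states up to and including the first entry in `Q`. -/
def hitPre (Q : Finset V) (x : ℕ → S) : List S := pre x (firstHit Q x + 1)

theorem measurableSet_hitPre (Q : Finset V) (l : List S) :
    MeasurableSet {x : ℕ → S | hitPre Q x = l} := by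
  have : {x : ℕ → S | hitPre Q x = l} =
      ⋃ n, ({x : ℕ → S | firstHit Q x = n} ∩ {x : ℕ → S | pre x (n + 1) = l}) := by
    ext x
    simp [hitPre]
  rw [this]
  refine MeasurableSet.iUnion fun n => (measurable_firstHit Q (measurableSet_singleton n)).inter ?_
  have hf : Measurable fun (x : ℕ → S) (i : Fin (n + 1)) => x i :=
    measurable_pi_lambda _ fun i => measurable_pi_apply _
  exact hf (Set.toFinite {y : Fin (n + 1) → S | List.ofFn y = l}).measurableSet

theorem pre_succ {A : Type*} (x : ℕ → A) (n : ℕ) : pre x (n + 1) = pre x n ++ [x n] := by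
  rw [pre, List.ofFn_succ']
  simp [pre, List.concat_eq_append]

theorem qList_hitPre {Q : Finset V} {x : ℕ → S} (h : ∃ n, (x n : V) ∈ Q) :
    qList Q (hitPre Q x) = [(x (firstHit Q x) : V)] := by
  rw [hitPre, pre_succ, qList_append]
  have h1 : qList Q (pre x (firstHit Q x)) = [] := by
    rw [qList, List.filter_eq_nil_iff]
    simp only [List.mem_map, pre, List.mem_ofFn, decide_eq_true_eq]
    rintro _ ⟨_, ⟨i, rfl⟩, rfl⟩
    exact Nat.notMem_of_lt_sInf (s := {n | (x n : V) ∈ Q}) i.2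
  rw [h1, List.nil_append]
  simp [qList, firstHit_mem h]

end Chains

/-! ### The synchronization of two Markov chains -/

section Synchronization

variable {V : Type*} [DecidableEq V] (S₁ S₂ : Finset V)

/-- The event `Δ`: both local trajectories reach `Q = S₁ ∩ S₂`, and the first states of `Q`
that they reach are equal. -/
def Delta : Set ((ℕ → S₁) × (ℕ → S₂)) :=
  {p | (∃ n, (p.1 n : V) ∈ S₁ ∩ S₂) ∧ (∃ n, (p.2 n : V) ∈ S₁ ∩ S₂) ∧
    (p.1 (firstHit (S₁ ∩ S₂) p.1) : V) = p.2 (firstHit (S₁ ∩ S₂) p.2)}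

variable {S₁ S₂}

/-- The random elementary trajectory `(X¹_1 … X¹_{τ¹}, X²_1 … X²_{τ²})`, defined on `Δ`. -/
def sigma0 (p : Delta S₁ S₂) : Elem S₁ S₂ :=
  ⟨⟨hitPre (S₁ ∩ S₂) p.1.1, hitPre (S₁ ∩ S₂) p.1.2, by
      rw [qList_hitPre p.2.1, qList_hitPre p.2.2.1, p.2.2.2]⟩,
    p.1.1 (firstHit (S₁ ∩ S₂) p.1.1), qList_hitPre p.2.1, by
      simp [hitPre, pre_succ], by
      simp [hitPre, pre_succ, p.2.2.2]⟩

theorem measurableSet_Delta : MeasurableSet (Delta S₁ S₂) := by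
  have key : Delta S₁ S₂ = ⋃ e : Elem S₁ S₂,
      {x : ℕ → S₁ | hitPre (S₁ ∩ S₂) x = e.traj.fst} ×ˢ
        {y : ℕ → S₂ | hitPre (S₁ ∩ S₂) y = e.traj.snd} := by
    ext p
    simp only [Set.mem_iUnion, Set.mem_prod, Set.mem_ofPred_eq]
    constructor
    · intro hp
      exact ⟨sigma0 ⟨p, hp⟩, rfl, rfl⟩
    · rintro ⟨⟨s, v, h1, h2, h3⟩, hx, hy⟩
      have hv : v ∈ S₁ ∩ S₂ := by
        have : v ∈ qList (S₁ ∩ S₂) s.fst := by simp [h1]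
        simpa using (List.mem_filter.1 this).2
      simp only at hx hy
      rw [← hx] at h2
      rw [← hy] at h3
      simp only [hitPre, pre_succ, List.map_append, List.map_cons, List.map_nil,
        List.getLast?_append_of_ne_nil _ (List.cons_ne_nil _ _), List.getLast?_singleton,
        Option.some.injEq] at h2 h3
      exact ⟨⟨_, h2 ▸ hv⟩, ⟨_, h3 ▸ hv⟩, h2.trans h3.symm⟩
  rw [key]
  exact MeasurableSet.iUnion fun e =>
    (measurableSet_hitPre _ _).prod (measurableSet_hitPre _ _)

theorem measurable_sigma0 : Measurable (sigma0 (S₁ := S₁) (S₂ := S₂)) := by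
  refine measurable_to_countable' fun e => ?_
  have : sigma0 ⁻¹' {e} = (Subtype.val : Delta S₁ S₂ → _) ⁻¹'
      ({x : ℕ → S₁ | hitPre (S₁ ∩ S₂) x = e.traj.fst} ×ˢ
        {y : ℕ → S₂ | hitPre (S₁ ∩ S₂) y = e.traj.snd}) := by
    ext p
    rw [Set.mem_preimage, Set.mem_singleton_iff, Elem.ext_iff, FinTraj.ext_iff]
    rfl
  rw [this]
  exact measurable_subtype_coe ((measurableSet_hitPre _ _).prod (measurableSet_hitPre _ _))

/-- The law `U_α` of the random elementary trajectory `sigma0` under `M¹_x ⊗ M²_z (· | Δ)`,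
where `α = (x, z)`. -/
def elemLaw (P₁ : PosTransition S₁) (P₂ : PosTransition S₂) (α : S₁ × S₂) :
    Measure (Elem S₁ S₂) :=
  (Measure.comap Subtype.val
    (cond ((P₁.law α.1).prod (P₂.law α.2)) (Delta S₁ S₂))).map sigma0

theorem law_Delta_ne_zero (P₁ : PosTransition S₁) (P₂ : PosTransition S₂)
    (hQ : (S₁ ∩ S₂).Nonempty) (α : S₁ × S₂) :
    ((P₁.law α.1).prod (P₂.law α.2)) (Delta S₁ S₂) ≠ 0 := by
  obtain ⟨q, hq⟩ := hQ
  have aux : ∀ {S : Finset V} (P : PosTransition S) (x : S) (y : S),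
      P.law x {w | w 0 = y} = ENNReal.ofReal (P.mat x y) := by
    intro S P x y
    rw [← P.kernel_singleton, ← chainLaw_zero (P.kernel x) P.kernel,
      Measure.map_apply (measurable_pi_apply 0) (measurableSet_singleton y)]
    rfl
  let q₁ : S₁ := ⟨q, (Finset.mem_inter.1 hq).1⟩
  let q₂ : S₂ := ⟨q, (Finset.mem_inter.1 hq).2⟩
  have hit : ∀ {S : Finset V} (y : S) (w : ℕ → S), (y : V) = q → w 0 = y →
      firstHit (S₁ ∩ S₂) w = 0 := by
    intro S y w hy hw
    exact Nat.sInf_eq_zero.2 (Or.inl (by simpa [hw, hy] using hq))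
  have hsub : {w : ℕ → S₁ | w 0 = q₁} ×ˢ {w : ℕ → S₂ | w 0 = q₂} ⊆ Delta S₁ S₂ := by
    rintro ⟨x, y⟩ ⟨hx, hy⟩
    simp only [Set.mem_ofPred_eq] at hx hy
    refine ⟨⟨0, by simpa [hx, q₁] using hq⟩, ⟨0, by simpa [hy, q₂] using hq⟩, ?_⟩
    simp only [hit q₁ x rfl hx, hit q₂ y rfl hy, hx, hy, q₁, q₂]
  refine ne_of_gt (lt_of_lt_of_le ?_ (measure_mono hsub))
  rw [Measure.prod_prod, aux, aux]
  exact ENNReal.mul_pos (ENNReal.ofReal_pos.2 (P₁.pos _ _)).ne'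
    (ENNReal.ofReal_pos.2 (P₂.pos _ _)).ne'

theorem isProbabilityMeasure_elemLaw (P₁ : PosTransition S₁) (P₂ : PosTransition S₂)
    (hQ : (S₁ ∩ S₂).Nonempty) (α : S₁ × S₂) : IsProbabilityMeasure (elemLaw P₁ P₂ α) := by
  have h := law_Delta_ne_zero P₁ P₂ hQ α
  have : IsProbabilityMeasure (Measure.comap (Subtype.val : Delta S₁ S₂ → _)
      (cond ((P₁.law α.1).prod (P₂.law α.2)) (Delta S₁ S₂))) := by
    constructor
    rw [comap_subtype_coe_apply measurableSet_Delta]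
    simp only [Set.image_univ, Subtype.range_coe_subtype, Set.ofPred_mem_eq]
    exact cond_apply_self h (measure_ne_top _ _)
  exact Measure.isProbabilityMeasure_map measurable_sigma0.aemeasurable

/-- The transition kernel `K(σ, ·) = U_{γ(σ)}` on the set of elementary trajectories. -/
def elemKernel (P₁ : PosTransition S₁) (P₂ : PosTransition S₂) :
    Kernel (Elem S₁ S₂) (Elem S₁ S₂) :=
  Kernel.ofFunOfCountable fun σ => elemLaw P₁ P₂ σ.last

theorem isMarkovKernel_elemKernel (P₁ : PosTransition S₁) (P₂ : PosTransition S₂)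
    (hQ : (S₁ ∩ S₂).Nonempty) : IsMarkovKernel (elemKernel P₁ P₂) :=
  ⟨fun σ => isProbabilityMeasure_elemLaw P₁ P₂ hQ σ.last⟩

/-- The law of the infinite concatenation of the Markov chain of elementary trajectories with
initial law `U_α` and transition kernel `K`. -/
def syncLaw (P₁ : PosTransition S₁) (P₂ : PosTransition S₂) (hQ : (S₁ ∩ S₂).Nonempty)
    (α : S₁ × S₂) : Measure (Omega S₁ S₂) :=
  haveI := isMarkovKernel_elemKernel P₁ P₂ hQ
  (chainLaw (elemLaw P₁ P₂ α) (elemKernel P₁ P₂)).map elemConcat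

/-- The set `X₀` of global states `(x, z)` such that `x = z` if both `x` and `z` are shared. -/
def syncStates (S₁ S₂ : Finset V) : Set (S₁ × S₂) :=
  {α | (α.1 : V) ∈ S₁ ∩ S₂ ∧ (α.2 : V) ∈ S₁ ∩ S₂ → (α.1 : V) = α.2}

/-- The synchronization of two Markov chains. -/
def sync (P₁ : PosTransition S₁) (P₂ : PosTransition S₂) (hQ : (S₁ ∩ S₂).Nonempty)
    (α : syncStates S₁ S₂) : Measure (Omega S₁ S₂) :=
  syncLaw P₁ P₂ hQ α.1

end Synchronization

end TwoComp

end

open MeasureTheory ProbabilityTheory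

noncomputable section

namespace TwoComp

/-! ### Prefixes of infinite sequences -/

section Prefixes

variable {A : Type*}

/-! Everything rests on the chain rule P_α(↑(s·t)) = P_α(↑s) P_{γ_α(s)}(↑t), proved as `chainRule`.
Cylinders form a generating π-system, so the chain rule identifies the future of s with P_{γ_α(s)}
(`future_syncLaw`). The rule is stable under concatenation, and a finite trajectory is a product of
elementary trajectories followed by a remainder without shared states. Two cases are left. If s is
elementary, the only elementary trajectory that can begin a point of ↑s is s itself. Splitting the
law at its first factor (`syncLaw_apply`) then leaves the single term U_α(s). If r has no shared
state, every elementary trajectory beginning a point of ↑r has the form r·e. The weight U_α(e) is a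
product of two path probabilities divided by the mass of Δ (`elemLaw_singleton`). Path probabilities
are multiplicative, so U_α(r·e) = c · U_{γ_α(r)}(e) with c independent of e: the change of
normalization is absorbed in c (`exists_elemLaw_prepend`). Taking t empty shows that c = P_α(↑r).
Stability of X₀ is combinatorial, and closedness holds surely, since each elementary factor
contributes one shared state. -/

theorem isPre_nil (x : ℕ → A) : IsPre [] x := fun _ h => absurd h (Nat.not_lt_zero _)

theorem isPre_iff_pre_eq {l : List A} {x : ℕ → A} : IsPre l x ↔ pre x l.length = l := by
  constructor
  · intro h
    rw [pre_eq_take h le_rfl, List.take_length]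
  · intro h i hi
    have : (pre x l.length)[i]'(by simpa [pre] using hi) = l[i] := by simp only [h]
    rw [← this]
    simp [pre]

theorem isPre_pre (x : ℕ → A) (n : ℕ) : IsPre (pre x n) x := fun i hi => by simp [pre]

theorem IsPre.of_prefix {l m : List A} {x : ℕ → A} (hm : IsPre m x) (h : l <+: m) : IsPre l x :=
  fun i hi => (h.getElem hi).trans (hm i (hi.trans_le h.length_le))

theorem IsPre.prefix_of_length_le {l m : List A} {x : ℕ → A} (hl : IsPre l x) (hm : IsPre m x)
    (h : l.length ≤ m.length) : l <+: m := by
  rw [← isPre_iff_pre_eq.1 hl, ← isPre_iff_pre_eq.1 hm]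
  exact pre_prefix x h

theorem IsPre.prefix_or_prefix {l m : List A} {x : ℕ → A} (hl : IsPre l x) (hm : IsPre m x) :
    l <+: m ∨ m <+: l :=
  (le_total l.length m.length).imp (hl.prefix_of_length_le hm) (hm.prefix_of_length_le hl)

theorem appendSeq_append (l m : List A) (x : ℕ → A) :
    appendSeq (l ++ m) x = appendSeq l (appendSeq m x) := by
  ext k
  simp only [appendSeq, List.length_append, List.getElem_append]
  split_ifs <;> first | rfl | omega | (congr 1; omega)

theorem isPre_append_iff {l m : List A} {x : ℕ → A} :
    IsPre (l ++ m) (appendSeq l x) ↔ IsPre m x := by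
  rw [isPre_iff_pre_eq, isPre_iff_pre_eq, List.length_append, pre_appendSeq,
    List.append_cancel_left_eq]

theorem isPre_appendSeq (l : List A) (x : ℕ → A) : IsPre l (appendSeq l x) := by
  have := (isPre_append_iff (l := l) (x := x)).2 (isPre_nil x)
  rwa [List.append_nil] at this

theorem IsPre.appendSeq_shift {l : List A} {x : ℕ → A} (h : IsPre l x) :
    appendSeq l (fun n => x (n + l.length)) = x := by
  ext k
  simp only [appendSeq]
  split_ifs with hk
  · exact h k hk
  · rw [Nat.sub_add_cancel (not_lt.1 hk)]

theorem appendSeq_injective (l : List A) : Function.Injective (appendSeq l : (ℕ → A) → ℕ → A) := by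
  intro x y h
  ext k
  have := congrFun h (l.length + k)
  simpa [appendSeq] using this

theorem isPre_cons_iff {y : A} {l : List A} {x : ℕ → A} :
    IsPre (y :: l) x ↔ y = x 0 ∧ IsPre l (fun n => x (n + 1)) := by
  constructor
  · intro h
    exact ⟨h 0 (by simp), fun i hi => h (i + 1) (by simpa using hi)⟩
  · rintro ⟨h0, h⟩ (_ | i) hi
    · exact h0
    · exact h i (by simpa using hi)

theorem measurableSet_isPre [MeasurableSpace A] [DiscreteMeasurableSpace A]
    (l : List A) : MeasurableSet {x : ℕ → A | IsPre l x} := by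
  have : {x : ℕ → A | IsPre l x} = ⋂ i : Fin l.length, (fun x : ℕ → A => x i) ⁻¹' {l[i]} := by
    ext x
    simp only [IsPre, Set.mem_ofPred_eq, Set.mem_iInter, Set.mem_preimage, Set.mem_singleton_iff]
    exact ⟨fun h i => (h i i.2).symm, fun h i hi => (h ⟨i, hi⟩).symm⟩
  rw [this]
  exact MeasurableSet.iInter fun i => measurable_pi_apply _ (MeasurableSet.of_discrete)

/-- Two prefixes of one sequence are comparable, so intersecting cylinders are nested. -/
theorem isPiSystem_isPre : IsPiSystem (Set.range fun l : List A => {x : ℕ → A | IsPre l x}) := by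
  rintro _ ⟨l, rfl⟩ _ ⟨m, rfl⟩ ⟨x, hl, hm⟩
  rcases IsPre.prefix_or_prefix hl hm with h | h
  · exact ⟨m, (Set.inter_eq_right.2 fun y hy => IsPre.of_prefix hy h).symm⟩
  · exact ⟨l, (Set.inter_eq_left.2 fun y hy => IsPre.of_prefix hy h).symm⟩

/-- Countability enters here: an event on one coordinate is the union of the countably many
cylinders that force it. -/
theorem generateFrom_isPre [Countable A] [MeasurableSpace A] [DiscreteMeasurableSpace A] :
    (MeasurableSpace.pi : MeasurableSpace (ℕ → A)) =
      MeasurableSpace.generateFrom (Set.range fun l : List A => {x : ℕ → A | IsPre l x}) := by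
  apply le_antisymm
  · refine iSup_le fun n => ?_
    rintro _ ⟨B, -, rfl⟩
    have : (fun x : ℕ → A => x n) ⁻¹' B =
        ⋃ l : {l : List A // ∃ h : n < l.length, l[n] ∈ B}, {x : ℕ → A | IsPre l.1 x} := by
      ext x
      simp only [Set.mem_preimage, Set.mem_iUnion, Set.mem_ofPred_eq, Subtype.exists]
      constructor
      · intro hx
        exact ⟨pre x (n + 1), ⟨by simp [pre], by rwa [isPre_pre x (n + 1)]⟩, isPre_pre x _⟩
      · rintro ⟨l, ⟨h, hB⟩, hl⟩
        rwa [← hl n h]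
    rw [this]
    exact MeasurableSet.iUnion fun l => MeasurableSpace.measurableSet_generateFrom ⟨l.1, rfl⟩
  · refine MeasurableSpace.generateFrom_le ?_
    rintro _ ⟨l, rfl⟩
    exact measurableSet_isPre l

theorem measurable_appendSeq [MeasurableSpace A] (l : List A) :
    Measurable (appendSeq l : (ℕ → A) → ℕ → A) := by
  refine measurable_pi_lambda _ fun k => ?_
  unfold appendSeq
  split_ifs
  · exact measurable_const
  · exact measurable_pi_apply _

end Prefixes

/-! ### Path probabilities of Markov chains -/

section PathWeight

variable {E : Type*} [MeasurableSpace E]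

/-- The probability that the chain with kernel `K` started at `x` follows the path `l`. -/
def pathWeight (K : Kernel E E) : E → List E → ENNReal
  | _, [] => 1
  | x, y :: l => K x {y} * pathWeight K y l

theorem pathWeight_append (K : Kernel E E) (x : E) (l m : List E) :
    pathWeight K x (l ++ m) = pathWeight K x l * pathWeight K (l.getLastD x) m := by
  induction l generalizing x with
  | nil => simp [pathWeight]
  | cons y l ih =>
    rw [List.cons_append, pathWeight, ih, pathWeight, mul_assoc, List.getLastD_cons]

variable [DiscreteMeasurableSpace E]

/-- The joint law of the history up to time `l.length` and the next state is a composition-product.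
On the histories following `y :: l`, the kernel's value depends only on their common last state, so
the integral is a product. -/
theorem chainLaw_isPre_append_singleton (μ : Measure E) [IsProbabilityMeasure μ] (K : Kernel E E)
    [IsMarkovKernel K] (y z : E) (l : List E) :
    chainLaw μ K {x | IsPre ((y :: l) ++ [z]) x} =
      chainLaw μ K {x | IsPre (y :: l) x} * K (l.getLastD y) {z} := by
  have hB : MeasurableSet {h : (Π _ : Finset.Iic l.length, E) |
      ∀ i (hi : i < (y :: l).length),
        (y :: l)[i] = h ⟨i, Finset.mem_Iic.2 (Nat.lt_succ_iff.1 hi)⟩} := by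
    simp only [Set.ofPred_forall]
    refine MeasurableSet.iInter fun i => MeasurableSet.iInter fun hi => ?_
    have : MeasurableSet ((fun h : (Π _ : Finset.Iic l.length, E) =>
        h ⟨i, Finset.mem_Iic.2 (Nat.lt_succ_iff.1 hi)⟩) ⁻¹' {(y :: l)[i]}) :=
      measurable_pi_apply _ MeasurableSet.of_discrete
    convert this using 1
    ext h
    simp [eq_comm]
  set B := {h : (Π _ : Finset.Iic l.length, E) |
      ∀ i (hi : i < (y :: l).length),
        (y :: l)[i] = h ⟨i, Finset.mem_Iic.2 (Nat.lt_succ_iff.1 hi)⟩} with hBdef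
  -- This repeats the kernels inside `chainLaw`, so that `hκ` holds by `rfl`.
  let κ : (n : ℕ) → Kernel (Π _ : Finset.Iic n, E) E := fun n =>
    K.comap (fun h : (Π _ : Finset.Iic n, E) => h ⟨n, Finset.mem_Iic.2 le_rfl⟩)
      (measurable_pi_apply _)
  have key := Kernel.map_frestrictLe_trajMeasure_compProd_eq_map_trajMeasure
    (X := fun _ => E) (μ₀ := μ) (κ := κ) (a := l.length)
  have hκ : Kernel.trajMeasure (X := fun _ => E) μ κ = chainLaw μ K := rfl
  rw [hκ] at key
  have hpre : {x : ℕ → E | IsPre (y :: l) x} =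
      (Preorder.frestrictLe (π := fun _ => E) l.length) ⁻¹' B := by
    ext x
    simp [IsPre, hBdef]
  have hpre' : {x : ℕ → E | IsPre ((y :: l) ++ [z]) x} =
      (fun x => (Preorder.frestrictLe (π := fun _ => E) l.length x, x (l.length + 1))) ⁻¹'
        (B ×ˢ {z}) := by
    ext x
    simp only [IsPre, hBdef, Set.mem_preimage, Set.mem_prod, Set.mem_ofPred_eq,
      Set.mem_singleton_iff, Preorder.frestrictLe_apply]
    constructor
    · intro h
      refine ⟨fun i hi => ?_, ?_⟩
      · rw [← h i (by simp at hi ⊢; omega), List.getElem_append_left hi]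
      · rw [← h (l.length + 1) (by simp)]
        simp
    · rintro ⟨h1, h2⟩ i hi
      rcases Nat.lt_or_ge i (y :: l).length with h | h
      · rw [List.getElem_append_left h, h1 i h]
      · have : i = l.length + 1 := by simp at hi h; omega
        subst this
        simp [h2]
  have hlast : ∀ h ∈ B, h ⟨l.length, Finset.mem_Iic.2 le_rfl⟩ = l.getLastD y := by
    intro h hh
    rw [← hh l.length (by simp)]
    rcases List.eq_nil_or_concat l with rfl | ⟨m, w, rfl⟩
    · simp
    · simp
  rw [hpre, hpre', ← Measure.map_apply (by fun_prop) (hB.prod (MeasurableSet.singleton z)), ← key,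
    Measure.compProd_apply_prod hB (MeasurableSet.singleton z),
    setLIntegral_congr_fun (g := fun _ => K (l.getLastD y) {z}) hB, setLIntegral_const,
    Measure.map_apply (by fun_prop) hB, mul_comm]
  intro h hh
  simp only [κ, Kernel.comap_apply, hlast h hh]

/-- The induction is on the right end, where the trajectory measure grows; `pathWeight_append`
reconciles this with the left recursion of `pathWeight`. -/
theorem chainLaw_isPre_cons (μ : Measure E) [IsProbabilityMeasure μ] (K : Kernel E E)
    [IsMarkovKernel K] (y : E) (l : List E) :
    chainLaw μ K {x | IsPre (y :: l) x} = μ {y} * pathWeight K y l := by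
  induction l using List.reverseRecOn with
  | nil =>
    conv_rhs => rw [← chainLaw_zero μ K]
    rw [Measure.map_apply (measurable_pi_apply 0) (MeasurableSet.singleton y), pathWeight, mul_one]
    congr 1
    ext x
    simp [isPre_cons_iff, isPre_nil, eq_comm]
  | append_singleton l z ih =>
    rw [← List.cons_append, chainLaw_isPre_append_singleton, ih, pathWeight_append, pathWeight,
      pathWeight, mul_one, mul_assoc]

theorem chainLaw_isPre (K : Kernel E E) [IsMarkovKernel K] (x : E) (l : List E) :
    chainLaw (K x) K {w | IsPre l w} = pathWeight K x l := by
  cases l with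
  | nil => simp [isPre_nil, pathWeight]
  | cons y l => rw [chainLaw_isPre_cons, pathWeight]

variable [Countable E]

/-- First-step decomposition of a homogeneous Markov chain. -/
theorem chainLaw_eq_sum (μ : Measure E) [IsProbabilityMeasure μ] (K : Kernel E E)
    [IsMarkovKernel K] :
    chainLaw μ K =
      Measure.sum fun e => μ {e} • (chainLaw (K e) K).map (appendSeq [e]) := by
  refine ext_of_generate_finite _ generateFrom_isPre isPiSystem_isPre ?_ ?_
  · rintro _ ⟨l, rfl⟩
    rw [Measure.sum_apply _ (measurableSet_isPre l)]
    simp only [Measure.smul_apply, smul_eq_mul,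
      Measure.map_apply (measurable_appendSeq _) (measurableSet_isPre l)]
    cases l with
    | nil =>
      simp only [isPre_nil, Set.ofPred_true, Set.preimage_univ, measure_univ, mul_one]
      -- On the countable discrete space `E` the point masses of `μ` add up to its total mass.
      rw [← measure_univ (μ := μ), ← μ.tsum_indicator_apply_singleton _ MeasurableSet.univ]
      simp
    | cons y l =>
      rw [chainLaw_isPre_cons, tsum_eq_single y]
      · rw [← chainLaw_isPre]
        congr 2
        ext x
        exact (isPre_append_iff (l := [y])).symm
      · intro e he
        have : (appendSeq [e] ⁻¹' {x : ℕ → E | IsPre (y :: l) x}) = ∅ := by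
          ext x
          simp only [Set.mem_preimage, Set.mem_ofPred_eq, isPre_cons_iff, Set.mem_empty_iff_false,
            iff_false]
          rintro ⟨h, -⟩
          exact he (by simpa [appendSeq] using h.symm)
        rw [this, measure_empty, mul_zero]
  · rw [Measure.sum_apply _ MeasurableSet.univ]
    simp only [Measure.smul_apply, smul_eq_mul,
      Measure.map_apply (measurable_appendSeq _) MeasurableSet.univ, Set.preimage_univ,
      measure_univ, mul_one]
    rw [← measure_univ (μ := μ), ← μ.tsum_indicator_apply_singleton _ MeasurableSet.univ]
    simp

/-- Every preimage is a countable union of cylinders, because the prefix of length `n` already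
decides the value of `f`. -/
theorem measurable_of_pre_congr {B : Type*} [MeasurableSpace B] (f : (ℕ → E) → B) (n : ℕ)
    (h : ∀ x y, pre x n = pre y n → f x = f y) : Measurable f := by
  intro s _
  have : f ⁻¹' s = ⋃ l : {l : List E // ∀ x, IsPre l x → f x ∈ s}, {x | IsPre l.1 x} := by
    ext x
    simp only [Set.mem_preimage, Set.mem_iUnion, Set.mem_ofPred_eq, Subtype.exists]
    constructor
    · intro hx
      refine ⟨pre x n, fun y hy => ?_, isPre_pre x n⟩
      have h' := isPre_iff_pre_eq.1 hy
      rw [show (pre x n).length = n by simp [pre]] at h'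
      rwa [h y x h']
    · rintro ⟨l, hl, hx⟩
      exact hl x hx
  rw [this]
  exact MeasurableSet.iUnion fun l => measurableSet_isPre l.1

end PathWeight

/-! ### Finite sequences with a single shared state, at their end -/

section EndsAt

variable {V : Type*} [DecidableEq V] {Q S : Finset V}

/-- The `Q`-sequence of `l` has the single term `v`, which is the last term of `l`. -/
def EndsAt (Q : Finset V) (l : List S) (v : V) : Prop :=
  qList Q l = [v] ∧ (l.map Subtype.val).getLast? = some v

theorem EndsAt.exists_eq_append {l : List S} {v : V} (h : EndsAt Q l v) :
    ∃ (a : List S) (q : S), l = a ++ [q] ∧ qList Q a = [] ∧ (q : V) = v ∧ v ∈ Q := by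
  obtain ⟨h1, h2⟩ := h
  rcases List.eq_nil_or_concat l with rfl | ⟨a, q, rfl⟩
  · simp at h2
  · simp only [List.concat_eq_append] at h1 h2 ⊢
    have hq : (q : V) = v := by simpa using h2
    have hv : v ∈ Q := by
      have : v ∈ qList Q (a ++ [q]) := by simp [h1]
      simpa using (List.mem_filter.1 this).2
    refine ⟨a, q, rfl, ?_, hq, hv⟩
    rw [qList_append] at h1
    have h3 : qList Q [q] = [v] := by simp [qList, hq, hv]
    rw [h3] at h1
    simpa using h1

theorem EndsAt.append {r m : List S} {v : V} (hr : qList Q r = []) (h : EndsAt Q m v) :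
    EndsAt Q (r ++ m) v := by
  obtain ⟨a, q, rfl, ha, hq, hv⟩ := h.exists_eq_append
  refine ⟨by rw [qList_append, hr, h.1, List.nil_append], ?_⟩
  simp [hq]

theorem EndsAt.of_append {r m : List S} {v : V} (hr : qList Q r = []) (h : EndsAt Q (r ++ m) v) :
    EndsAt Q m v := by
  have h1 : qList Q m = [v] := by
    have := h.1
    rwa [qList_append, hr, List.nil_append] at this
  have hm : m ≠ [] := by
    rintro rfl
    simp [qList] at h1
  refine ⟨h1, ?_⟩
  have := h.2
  rwa [List.map_append, List.getLast?_append_of_ne_nil _ (mt List.map_eq_nil_iff.1 hm)] at this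

/-- A list whose only shared state is its last one stops exactly at the first hit of any sequence
extending it. Stopping events thus become cylinders, whose probabilities are path weights. -/
theorem hitPre_eq_iff_isPre {l : List S} {v : V} (h : EndsAt Q l v) (w : ℕ → S) :
    hitPre Q w = l ↔ IsPre l w := by
  constructor
  · rintro rfl
    exact isPre_pre w _
  · intro hw
    obtain ⟨a, q, rfl, ha, hq, hv⟩ := h.exists_eq_append
    have hfirst : firstHit Q w = a.length := by
      have hmem : (w a.length : V) ∈ Q := by
        rw [← hw a.length (by simp)]
        simpa [hq] using hv
      refine le_antisymm (Nat.sInf_le hmem) ?_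
      by_contra hlt
      rw [not_le] at hlt
      have hin := firstHit_mem (Q := Q) ⟨_, hmem⟩
      rw [← hw _ (by simp; omega), List.getElem_append_left hlt] at hin
      have : ((a[firstHit Q w] : S) : V) ∈ qList Q a :=
        List.mem_filter.2 ⟨List.mem_map.2 ⟨_, List.getElem_mem _, rfl⟩, by simpa using hin⟩
      simp [ha] at this
    have := isPre_iff_pre_eq.1 hw
    rw [hitPre, hfirst]
    simpa using this

theorem EndsAt.eq_of_isPre {l m : List S} {v w : V} (hl : EndsAt Q l v) (hm : EndsAt Q m w)
    {x : ℕ → S} (hlx : IsPre l x) (hmx : IsPre m x) : l = m := by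
  rw [← (hitPre_eq_iff_isPre hl x).2 hlx, (hitPre_eq_iff_isPre hm x).2 hmx]

/-- The two prefixes are comparable, and `l` cannot be a prefix of `r`, since it contains a shared
state. -/
theorem EndsAt.exists_append_of_isPre {r l : List S} {v : V} (hr : qList Q r = [])
    (hl : EndsAt Q l v) {x : ℕ → S} (hrx : IsPre r x) (hlx : IsPre l x) :
    ∃ m, l = r ++ m ∧ EndsAt Q m v := by
  rcases hrx.prefix_or_prefix hlx with h | h
  · obtain ⟨m, rfl⟩ := h
    exact ⟨m, rfl, hl.of_append hr⟩
  · have := qList_prefix Q h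
    rw [hr, hl.1] at this
    simp at this

theorem exists_endsAt_append {l : List S} {v : V} {t : List V} (h : qList Q l = v :: t) :
    ∃ a b, l = a ++ b ∧ EndsAt Q a v ∧ qList Q b = t := by
  induction l with
  | nil => simp [qList] at h
  | cons x l ih =>
    by_cases hx : (x : V) ∈ Q
    · have : (x : V) :: qList Q l = v :: t := by
        rw [← h]
        simp [qList, hx]
      obtain ⟨rfl, rfl⟩ := List.cons.inj this
      exact ⟨[x], l, rfl, ⟨by simp [qList, hx], by simp⟩, rfl⟩
    · have hx' : qList Q [x] = [] := by simp [qList, hx]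
      have : qList Q l = v :: t := by
        rw [← h]
        simp [qList, hx]
      obtain ⟨a, b, rfl, ha, hb⟩ := ih this
      exact ⟨[x] ++ a, b, rfl, ha.append hx', hb⟩

theorem exists_prefix_qList_eq {m : List S} {L : List V} (h : L <+: qList Q m) :
    ∃ m', m' <+: m ∧ qList Q m' = L := by
  obtain ⟨l, hl, rfl⟩ := List.prefix_filter_iff.1 h
  obtain ⟨l', hl', rfl⟩ := List.prefix_map_iff.1 hl
  exact ⟨l', hl', rfl⟩

/-- If two infinite sequences induce the same `Q`-sequence, the `Q`-sequence of a prefix of the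
first one is induced by a prefix of the second one. -/
theorem exists_isPre_qList_eq {T : Finset V} {x : ℕ → S} {y : ℕ → T}
    (hxy : ∀ n v, IsQTerm Q x n v ↔ IsQTerm Q y n v) (k : ℕ) :
    ∃ m, IsPre m y ∧ qList Q m = qList Q (pre x k) := by
  induction k with
  | zero => exact ⟨[], isPre_nil y, rfl⟩
  | succ k ih =>
    obtain ⟨m, hm, hmq⟩ := ih
    by_cases hx : (x k : V) ∈ Q
    · have hx' : qList Q (pre x (k + 1)) = qList Q (pre x k) ++ [(x k : V)] := by
        rw [pre_succ, qList_append]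
        simp [qList, hx]
      -- The new shared term `x k` has index equal to the number of earlier ones; some prefix of `y`
      -- must show it. That prefix may show more terms and is cut back below.
      obtain ⟨j, hj⟩ := (hxy (qList Q (pre x k)).length (x k)).1 ⟨k + 1, by simp [hx']⟩
      have hpref : qList Q m <+: qList Q (pre y j) := by
        rcases hm.prefix_or_prefix (isPre_pre y j) with h | h
        · exact qList_prefix Q h
        · have := (List.getElem?_eq_some_iff.1 (getElem?_of_prefix (qList_prefix Q h) hj)).1
          rw [hmq] at this
          omega
      obtain ⟨t, ht⟩ := hpref
      rw [hmq] at ht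
      rw [← ht, List.getElem?_append_right le_rfl, Nat.sub_self] at hj
      obtain ⟨t', rfl⟩ : ∃ t', t = (x k : V) :: t' := by
        cases t with
        | nil => simp at hj
        | cons a t' => exact ⟨t', by simpa using hj⟩
      obtain ⟨m', hm', hq⟩ := exists_prefix_qList_eq (Q := Q) (m := pre y j)
        (L := qList Q (pre x k) ++ [(x k : V)]) (by rw [← ht]; exact ⟨t', by simp⟩)
      exact ⟨m', (isPre_pre y j).of_prefix hm', by rw [hq, hx']⟩
    · refine ⟨m, hm, ?_⟩
      rw [hmq, pre_succ, qList_append]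
      simp [qList, hx]

end EndsAt

/-! ### Concatenation of trajectories and cylinders -/

section Cylinders

variable {V : Type*} [DecidableEq V] {S₁ S₂ : Finset V}

/-- The empty trajectory. -/
def FinTraj.nil : FinTraj S₁ S₂ := ⟨[], [], rfl⟩

/-- Componentwise concatenation of finite trajectories. -/
def FinTraj.append (s t : FinTraj S₁ S₂) : FinTraj S₁ S₂ :=
  ⟨s.fst ++ t.fst, s.snd ++ t.snd, by rw [qList_append, qList_append, s.sync, t.sync]⟩

theorem FinTraj.append_nil (s : FinTraj S₁ S₂) : s.append .nil = s := by
  ext1 <;> simp [FinTraj.append, FinTraj.nil]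

theorem FinTraj.append_assoc (s t u : FinTraj S₁ S₂) :
    (s.append t).append u = s.append (t.append u) := by
  ext1 <;> simp [FinTraj.append]

instance : Countable (FinTraj S₁ S₂) := by
  refine Function.Injective.countable (f := fun s : FinTraj S₁ S₂ => (s.fst, s.snd)) ?_
  rintro s t h
  simp only [Prod.mk.injEq] at h
  exact FinTraj.ext h.1 h.2

theorem getLastD_append {A : Type*} (l m : List A) (a : A) :
    (l ++ m).getLastD a = m.getLastD (l.getLastD a) := by
  rcases List.eq_nil_or_concat m with rfl | ⟨m, b, rfl⟩
  · simp
  · simp [← List.append_assoc]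

theorem gam_append (α : S₁ × S₂) (s t : FinTraj S₁ S₂) :
    gam α (s.append t) = gam (gam α s) t := by
  simp only [gam, FinTraj.append, getLastD_append]

theorem cyl_nil : cyl (FinTraj.nil : FinTraj S₁ S₂) = Set.univ :=
  Set.eq_univ_of_forall fun ω => ⟨isPre_nil ω.fst, isPre_nil ω.snd⟩

theorem concat_append (s t : FinTraj S₁ S₂) (ω : Omega S₁ S₂) :
    concat (s.append t) ω = concat s (concat t ω) := by
  ext1 <;> simp [concat, FinTraj.append, appendSeq_append]

theorem concat_mem_cyl_append {s t : FinTraj S₁ S₂} {ω : Omega S₁ S₂} :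
    concat s ω ∈ cyl (s.append t) ↔ ω ∈ cyl t :=
  and_congr isPre_append_iff isPre_append_iff

theorem concat_mem_cyl (s : FinTraj S₁ S₂) (ω : Omega S₁ S₂) : concat s ω ∈ cyl s :=
  ⟨isPre_appendSeq _ _, isPre_appendSeq _ _⟩

theorem preimage_concat_cyl_append (s t : FinTraj S₁ S₂) :
    concat s ⁻¹' cyl (s.append t) = cyl t :=
  Set.ext fun _ => concat_mem_cyl_append

theorem cyl_append_subset (s t : FinTraj S₁ S₂) : cyl (s.append t) ⊆ cyl s := fun _ h =>
  ⟨IsPre.of_prefix h.1 (List.prefix_append _ _), IsPre.of_prefix h.2 (List.prefix_append _ _)⟩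

theorem concat_injective (s : FinTraj S₁ S₂) : Function.Injective (concat s) := fun _ _ h =>
  Omega.ext (appendSeq_injective _ (congrArg Omega.fst h))
    (appendSeq_injective _ (congrArg Omega.snd h))

theorem isQTerm_appendSeq_add (Q : Finset V) {S : Finset V} (l : List S) (x : ℕ → S)
    (n : ℕ) (v : V) :
    IsQTerm Q (appendSeq l x) (n + (qList Q l).length) v ↔ IsQTerm Q x n v := by
  rw [isQTerm_appendSeq]
  simp

/-- Removing `s` deletes equally many terms from both `Q`-sequences, so the shifted components still
synchronize. -/
theorem range_concat (s : FinTraj S₁ S₂) : Set.range (concat s) = cyl s := by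
  ext ω
  constructor
  · rintro ⟨ω', rfl⟩
    exact concat_mem_cyl s ω'
  · rintro ⟨h1, h2⟩
    refine ⟨⟨fun n => ω.fst (n + s.fst.length), fun n => ω.snd (n + s.snd.length),
      fun n v => ?_⟩, Omega.ext h1.appendSeq_shift h2.appendSeq_shift⟩
    rw [← isQTerm_appendSeq_add _ s.fst, ← isQTerm_appendSeq_add _ s.snd, h1.appendSeq_shift,
      h2.appendSeq_shift, s.sync]
    exact ω.sync _ _

theorem image_concat_cyl (s t : FinTraj S₁ S₂) : concat s '' cyl t = cyl (s.append t) := by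
  rw [← preimage_concat_cyl_append s t, Set.image_preimage_eq_inter_range, range_concat,
    Set.inter_eq_left]
  exact cyl_append_subset s t

theorem measurableSet_cyl (s : FinTraj S₁ S₂) : MeasurableSet (cyl s) :=
  MeasurableSpace.measurableSet_generateFrom ⟨s, rfl⟩

/-- `Measure.comap` in `future` is meaningful only if images of measurable sets are measurable.
Injectivity settles complements: their images are differences inside `cyl s`. -/
theorem measurableSet_image_concat (s : FinTraj S₁ S₂) {A : Set (Omega S₁ S₂)}
    (hA : MeasurableSet A) : MeasurableSet (concat s '' A) := by
  refine MeasurableSpace.generateFrom_induction (Set.range (cyl (S₁ := S₁) (S₂ := S₂)))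
    (fun A _ => MeasurableSet (concat s '' A)) ?_ ?_ ?_ ?_ A hA
  · rintro _ ⟨t, rfl⟩ -
    rw [image_concat_cyl]
    exact measurableSet_cyl _
  · simp
  · intro A _ h
    rw [Set.image_compl_eq_range_sdiff_image (concat_injective s), range_concat]
    exact (measurableSet_cyl s).diff h
  · intro f _ h
    rw [Set.image_iUnion]
    exact MeasurableSet.iUnion h

/-- Prefixes are comparable in each component. When the comparisons go in opposite directions, the
two longer components still form a trajectory: their `Q`-sequences are prefixes of one another by
the synchronization of `s` and `t`, hence equal. -/
theorem isPiSystem_cyl : IsPiSystem (Set.range (cyl (S₁ := S₁) (S₂ := S₂))) := by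
  have key : ∀ {s t : FinTraj S₁ S₂}, s.fst <+: t.fst → t.snd <+: s.snd →
      ∃ u : FinTraj S₁ S₂, u.fst = t.fst ∧ u.snd = s.snd := by
    intro s t h1 h2
    refine ⟨⟨t.fst, s.snd, ?_⟩, rfl, rfl⟩
    have h1' := qList_prefix (S₁ ∩ S₂) h1
    have h2' := qList_prefix (S₁ ∩ S₂) h2
    rw [← t.sync] at h2'
    rw [s.sync] at h1'
    exact h2'.eq_of_length (le_antisymm h2'.length_le h1'.length_le)
  have inter : ∀ {S : Finset V} {l m : List S} {x : ℕ → S}, l <+: m →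
      (IsPre l x ∧ IsPre m x ↔ IsPre m x) :=
    fun h => ⟨And.right, fun hm => ⟨hm.of_prefix h, hm⟩⟩
  have inter' : ∀ {S : Finset V} {l m : List S} {x : ℕ → S}, m <+: l →
      (IsPre l x ∧ IsPre m x ↔ IsPre l x) :=
    fun h => ⟨And.left, fun hl => ⟨hl, hl.of_prefix h⟩⟩
  rintro _ ⟨s, rfl⟩ _ ⟨t, rfl⟩ ⟨ω, hs, ht⟩
  have comm : ∀ ω : Omega S₁ S₂, ω ∈ cyl s ∩ cyl t ↔
      (IsPre s.fst ω.fst ∧ IsPre t.fst ω.fst) ∧ (IsPre s.snd ω.snd ∧ IsPre t.snd ω.snd) :=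
    fun ω => and_and_and_comm
  rcases hs.1.prefix_or_prefix ht.1 with h1 | h1 <;> rcases hs.2.prefix_or_prefix ht.2 with h2 | h2
  · refine ⟨t, Set.ext fun ω => ?_⟩
    rw [comm, inter h1, inter h2]
    rfl
  · obtain ⟨u, hu1, hu2⟩ := key h1 h2
    refine ⟨u, Set.ext fun ω => ?_⟩
    rw [comm, inter h1, inter' h2, ← hu1, ← hu2]
    rfl
  · obtain ⟨u, hu1, hu2⟩ := key h1 h2
    refine ⟨u, Set.ext fun ω => ?_⟩
    rw [comm, inter' h1, inter h2, ← hu1, ← hu2]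
    rfl
  · refine ⟨s, Set.ext fun ω => ?_⟩
    rw [comm, inter' h1, inter' h2]
    rfl

/-- A prefix of the first component alone is not a cylinder of `Ω`. It is a countable union of
cylinders, since synchronization supplies a matching prefix of the second component. -/
theorem measurable_fst : Measurable (Omega.fst : Omega S₁ S₂ → ℕ → S₁) := by
  rw [generateFrom_isPre]
  refine measurable_generateFrom ?_
  rintro _ ⟨l, rfl⟩
  have : Omega.fst ⁻¹' {x : ℕ → S₁ | IsPre l x} =
      ⋃ s : {s : FinTraj S₁ S₂ // s.fst = l}, cyl s.1 := by
    ext ω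
    simp only [Set.mem_preimage, Set.mem_ofPred_eq, Set.mem_iUnion, Subtype.exists]
    constructor
    · intro h
      obtain ⟨m, hm, hq⟩ := exists_isPre_qList_eq ω.sync l.length
      rw [isPre_iff_pre_eq.1 h] at hq
      exact ⟨⟨l, m, hq.symm⟩, rfl, h, hm⟩
    · rintro ⟨s, rfl, h⟩
      exact h.1
  rw [this]
  exact MeasurableSet.iUnion fun s => measurableSet_cyl s.1

theorem measurable_snd : Measurable (Omega.snd : Omega S₁ S₂ → ℕ → S₂) := by
  rw [generateFrom_isPre]
  refine measurable_generateFrom ?_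
  rintro _ ⟨l, rfl⟩
  have : Omega.snd ⁻¹' {x : ℕ → S₂ | IsPre l x} =
      ⋃ s : {s : FinTraj S₁ S₂ // s.snd = l}, cyl s.1 := by
    ext ω
    simp only [Set.mem_preimage, Set.mem_ofPred_eq, Set.mem_iUnion, Subtype.exists]
    constructor
    · intro h
      obtain ⟨m, hm, hq⟩ := exists_isPre_qList_eq (fun n v => (ω.sync n v).symm) l.length
      rw [isPre_iff_pre_eq.1 h] at hq
      exact ⟨⟨m, l, hq⟩, rfl, hm, h⟩
    · rintro ⟨s, rfl, h⟩
      exact h.2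
  rw [this]
  exact MeasurableSet.iUnion fun s => measurableSet_cyl s.1

theorem measurable_of_measurable_components {B : Type*} [MeasurableSpace B] {f : B → Omega S₁ S₂}
    (h1 : Measurable fun b => (f b).fst) (h2 : Measurable fun b => (f b).snd) : Measurable f := by
  refine measurable_generateFrom ?_
  rintro _ ⟨s, rfl⟩
  exact (h1 (measurableSet_isPre s.fst)).inter (h2 (measurableSet_isPre s.snd))

theorem measurable_concat (s : FinTraj S₁ S₂) : Measurable (concat s) :=
  measurable_of_measurable_components ((measurable_appendSeq _).comp measurable_fst)
    ((measurable_appendSeq _).comp measurable_snd)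

theorem measurableSet_infinite_qSequence :
    MeasurableSet {ω : Omega S₁ S₂ | ∀ n, ∃ v, IsQTerm (S₁ ∩ S₂) ω.fst n v} := by
  have : {ω : Omega S₁ S₂ | ∀ n, ∃ v, IsQTerm (S₁ ∩ S₂) ω.fst n v} =
      ⋂ n, ⋃ l : {l : List S₁ // n < (qList (S₁ ∩ S₂) l).length},
        Omega.fst ⁻¹' {x | IsPre l.1 x} := by
    ext ω
    simp only [Set.mem_ofPred_eq, Set.mem_iInter, Set.mem_iUnion, Set.mem_preimage, Subtype.exists]
    refine forall_congr' fun n => ⟨?_, ?_⟩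
    · rintro ⟨v, k, hk⟩
      exact ⟨_, (List.getElem?_eq_some_iff.1 hk).1, isPre_pre _ k⟩
    · rintro ⟨l, hl, hx⟩
      refine ⟨(qList (S₁ ∩ S₂) l)[n], l.length, ?_⟩
      rw [isPre_iff_pre_eq.1 hx, List.getElem?_eq_getElem hl]
  rw [this]
  exact MeasurableSet.iInter fun n => MeasurableSet.iUnion fun l =>
    measurable_fst (measurableSet_isPre l.1)

end Cylinders

/-! ### Infinite concatenations of elementary trajectories -/

section ElemConcat

variable {V : Type*} [DecidableEq V] {S₁ S₂ : Finset V}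

theorem Elem.endsAt (e : Elem S₁ S₂) :
    ∃ v, EndsAt (S₁ ∩ S₂) e.traj.fst v ∧ EndsAt (S₁ ∩ S₂) e.traj.snd v := by
  obtain ⟨v, h1, h2, h3⟩ := e.elem
  exact ⟨v, ⟨h1, h2⟩, ⟨by rw [← e.traj.sync, h1], h3⟩⟩

/-- The elementary trajectory with components `l` and `m`. -/
def Elem.mk' (l : List S₁) (m : List S₂) (v : V) (hl : EndsAt (S₁ ∩ S₂) l v)
    (hm : EndsAt (S₁ ∩ S₂) m v) : Elem S₁ S₂ :=
  ⟨⟨l, m, hl.1.trans hm.1.symm⟩, v, hl.1, hl.2, hm.2⟩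

theorem Elem.gam_traj (e : Elem S₁ S₂) (α : S₁ × S₂) : gam α e.traj = e.last := by
  simp [gam, Elem.last, List.getLastD_eq_getLast?, List.getLast?_eq_some_getLast e.fst_ne_nil,
    List.getLast?_eq_some_getLast e.snd_ne_nil]

/-- `flat` grows on the right, whereas the first-step decomposition removes a factor on the left. -/
theorem flat_succ_eq {A : Type*} {l l' : ℕ → List A} (h : ∀ n, l (n + 1) = l' n) (n : ℕ) :
    flat l (n + 1) = l 0 ++ flat l' n := by
  induction n with
  | zero => simp [flat]
  | succ n ih => rw [flat, ih, flat, h, List.append_assoc]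

theorem infConcat_eq_appendSeq {A : Type*} {l l' : ℕ → List A} (hl : ∀ n, l n ≠ [])
    (hl' : ∀ n, l' n ≠ []) (h : ∀ n, l (n + 1) = l' n) :
    infConcat l hl = appendSeq (l 0) (infConcat l' hl') := by
  ext k
  have : IsPre (flat l (k + 1)) (appendSeq (l 0) (infConcat l' hl')) := by
    rw [flat_succ_eq h, isPre_append_iff]
    exact isPre_flat l' hl' k
  exact this k _

theorem elemConcat_appendSeq (e : Elem S₁ S₂) (τ : ℕ → Elem S₁ S₂) :
    elemConcat (appendSeq [e] τ) = concat e.traj (elemConcat τ) :=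
  Omega.ext
    (infConcat_eq_appendSeq (l := fun n => (appendSeq [e] τ n).traj.fst)
      (fun n => (appendSeq [e] τ n).fst_ne_nil) (fun n => (τ n).fst_ne_nil)
      fun n => by simp [appendSeq])
    (infConcat_eq_appendSeq (l := fun n => (appendSeq [e] τ n).traj.snd)
      (fun n => (appendSeq [e] τ n).snd_ne_nil) (fun n => (τ n).snd_ne_nil)
      fun n => by simp [appendSeq])

theorem flat_congr {A : Type*} {l l' : ℕ → List A} {n : ℕ} (h : ∀ i < n, l i = l' i) :
    flat l n = flat l' n := by
  induction n with
  | zero => rfl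
  | succ n ih =>
    rw [flat, flat, ih fun i hi => h i (hi.trans n.lt_succ_self), h n n.lt_succ_self]

theorem measurable_infConcat {E A : Type*} [MeasurableSpace E] [DiscreteMeasurableSpace E]
    [Countable E] [MeasurableSpace A] (f : E → List A) (hf : ∀ e, f e ≠ []) :
    Measurable fun τ : ℕ → E => infConcat (fun n => f (τ n)) fun n => hf (τ n) := by
  -- The lists are nonempty, so the first `k + 1` of them determine the letter of index `k`.
  refine measurable_pi_lambda _ fun k => measurable_of_pre_congr _ (k + 1) fun x y hxy => ?_
  have : flat (fun n => f (x n)) (k + 1) = flat (fun n => f (y n)) (k + 1) := by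
    refine flat_congr fun i hi => ?_
    have hx := isPre_pre x (k + 1) i (by simpa [pre] using hi)
    have hy := isPre_pre y (k + 1) i (by simpa [pre] using hi)
    rw [← hx, ← hy]
    simp only [hxy]
  simp only [infConcat, this]

theorem measurable_elemConcat : Measurable (elemConcat (S₁ := S₁) (S₂ := S₂)) :=
  measurable_of_measurable_components
    (measurable_infConcat (fun e : Elem S₁ S₂ => e.traj.fst) fun e => e.fst_ne_nil)
    (measurable_infConcat (fun e : Elem S₁ S₂ => e.traj.snd) fun e => e.snd_ne_nil)

theorem length_qList_flat (τ : ℕ → Elem S₁ S₂) (N : ℕ) :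
    (qList (S₁ ∩ S₂) (flat (fun n => (τ n).traj.fst) N)).length = N := by
  induction N with
  | zero => rfl
  | succ N ih =>
    obtain ⟨v, hv, -⟩ := (τ N).endsAt
    rw [flat, qList_append, List.length_append, ih, hv.1, List.length_singleton]

theorem exists_isQTerm_elemConcat (τ : ℕ → Elem S₁ S₂) (n : ℕ) :
    ∃ v, IsQTerm (S₁ ∩ S₂) (elemConcat τ).fst n v := by
  have h : n < (qList (S₁ ∩ S₂) (flat (fun n => (τ n).traj.fst) (n + 1))).length := by
    rw [length_qList_flat]
    exact n.lt_succ_self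
  exact ⟨_, (isQTerm_infConcat _ _ (fun n => (τ n).fst_ne_nil) _ _).2 ⟨n + 1, List.getElem?_eq_getElem h⟩⟩

end ElemConcat

/-! ### The law of the first elementary trajectory -/

section ElemLaw

variable {V : Type*} [DecidableEq V] {S₁ S₂ : Finset V}

/-- Both components of `e` end at the same shared state. Conditioning on `Delta` therefore only
rescales the probability of `e`. -/
theorem hitPre_prod_subset_Delta (e : Elem S₁ S₂) :
    {x : ℕ → S₁ | hitPre (S₁ ∩ S₂) x = e.traj.fst} ×ˢ
      {y : ℕ → S₂ | hitPre (S₁ ∩ S₂) y = e.traj.snd} ⊆ Delta S₁ S₂ := by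
  rintro ⟨x, y⟩ ⟨hx, hy⟩
  simp only [Set.mem_ofPred_eq] at hx hy
  obtain ⟨v, h1, h2⟩ := e.endsAt
  obtain ⟨-, -, -, -, -, hv⟩ := h1.exists_eq_append
  have hx' := h1.2
  have hy' := h2.2
  rw [← hx] at hx'
  rw [← hy] at hy'
  simp only [hitPre, pre_succ, List.map_append, List.map_cons, List.map_nil,
    List.getLast?_append_of_ne_nil _ (List.cons_ne_nil _ _), List.getLast?_singleton,
    Option.some.injEq] at hx' hy'
  exact ⟨⟨_, hx' ▸ hv⟩, ⟨_, hy' ▸ hv⟩, hx'.trans hy'.symm⟩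

theorem law_hitPre (P : PosTransition S₁) {Q : Finset V} (x : S₁) {l : List S₁} {v : V}
    (h : EndsAt Q l v) : P.law x {w | hitPre Q w = l} = pathWeight P.kernel x l := by
  simp only [hitPre_eq_iff_isPre h]
  exact chainLaw_isPre P.kernel x l

theorem elemLaw_singleton (P₁ : PosTransition S₁) (P₂ : PosTransition S₂) (α : S₁ × S₂)
    (e : Elem S₁ S₂) :
    elemLaw P₁ P₂ α {e} = (((P₁.law α.1).prod (P₂.law α.2)) (Delta S₁ S₂))⁻¹ *
      (pathWeight P₁.kernel α.1 e.traj.fst * pathWeight P₂.kernel α.2 e.traj.snd) := by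
  obtain ⟨v, h1, h2⟩ := e.endsAt
  have : (Subtype.val : Delta S₁ S₂ → _) '' (sigma0 ⁻¹' {e}) =
      {x : ℕ → S₁ | hitPre (S₁ ∩ S₂) x = e.traj.fst} ×ˢ
        {y : ℕ → S₂ | hitPre (S₁ ∩ S₂) y = e.traj.snd} := by
    ext p
    simp only [Set.mem_image, Set.mem_preimage, Set.mem_singleton_iff, Subtype.exists,
      exists_and_right, exists_eq_right]
    constructor
    · rintro ⟨hp, rfl⟩
      exact ⟨rfl, rfl⟩
    · intro hp
      exact ⟨hitPre_prod_subset_Delta e hp, Elem.ext (FinTraj.ext hp.1 hp.2)⟩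
  rw [elemLaw, Measure.map_apply measurable_sigma0 (MeasurableSet.singleton e),
    comap_subtype_coe_apply measurableSet_Delta, this, cond_apply measurableSet_Delta,
    Set.inter_eq_right.2 (hitPre_prod_subset_Delta e), Measure.prod_prod, law_hitPre P₁ _ h1,
    law_hitPre P₂ _ h2]

/-- The elementary trajectory `r · e`, where `r` contains no shared state. -/
def Elem.prepend (r : FinTraj S₁ S₂) (hr : qList (S₁ ∩ S₂) r.fst = []) (e : Elem S₁ S₂) :
    Elem S₁ S₂ :=
  ⟨r.append e.traj, by
    obtain ⟨v, h1, h2⟩ := e.endsAt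
    exact ⟨v, (h1.append hr).1, (h1.append hr).2, (h2.append (r.sync ▸ hr)).2⟩⟩

theorem Elem.prepend_injective (r : FinTraj S₁ S₂) (hr : qList (S₁ ∩ S₂) r.fst = []) :
    Function.Injective (Elem.prepend r hr) := by
  intro e e' h
  have h' := congrArg Elem.traj h
  exact Elem.ext (FinTraj.ext (List.append_cancel_left (congrArg FinTraj.fst h'))
    (List.append_cancel_left (congrArg FinTraj.snd h')))

theorem Elem.last_prepend (r : FinTraj S₁ S₂) (hr : qList (S₁ ∩ S₂) r.fst = [])
    (e : Elem S₁ S₂) : (e.prepend r hr).last = e.last := by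
  rw [← Elem.gam_traj _ e.last, Elem.prepend, gam_append, Elem.gam_traj]

/-- The path weights of `r` factor out, and the two normalizing masses do not depend on `e`. The
mass at `gam α r` must be nonzero and finite to be cancelled. -/
theorem exists_elemLaw_prepend (P₁ : PosTransition S₁) (P₂ : PosTransition S₂)
    (hQ : (S₁ ∩ S₂).Nonempty) (α : S₁ × S₂) (r : FinTraj S₁ S₂)
    (hr : qList (S₁ ∩ S₂) r.fst = []) :
    ∃ c, ∀ e : Elem S₁ S₂,
      elemLaw P₁ P₂ α {e.prepend r hr} = c * elemLaw P₁ P₂ (gam α r) {e} := by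
  set D : S₁ × S₂ → ENNReal := fun β => ((P₁.law β.1).prod (P₂.law β.2)) (Delta S₁ S₂) with hD
  refine ⟨(D α)⁻¹ * (pathWeight P₁.kernel α.1 r.fst * pathWeight P₂.kernel α.2 r.snd) *
    D (gam α r), fun e => ?_⟩
  have h0 : D (gam α r) * (D (gam α r))⁻¹ = 1 :=
    ENNReal.mul_inv_cancel (law_Delta_ne_zero P₁ P₂ hQ _) (measure_ne_top _ _)
  rw [elemLaw_singleton, elemLaw_singleton]
  simp only [Elem.prepend, FinTraj.append, pathWeight_append]
  change (D α)⁻¹ * (_ * pathWeight _ (gam α r).1 _ * (_ * pathWeight _ (gam α r).2 _)) =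
    _ * ((D (gam α r))⁻¹ * _)
  calc _ = (D α)⁻¹ * (pathWeight P₁.kernel α.1 r.fst * pathWeight P₂.kernel α.2 r.snd) *
        (D (gam α r) * (D (gam α r))⁻¹) * (pathWeight P₁.kernel (gam α r).1 e.traj.fst *
          pathWeight P₂.kernel (gam α r).2 e.traj.snd) := by rw [h0]; ring
    _ = _ := by ring

end ElemLaw

/-! ### The Markov property of the synchronization -/

section SyncLaw

variable {V : Type*} [DecidableEq V] {S₁ S₂ : Finset V}
  (P₁ : PosTransition S₁) (P₂ : PosTransition S₂) (hQ : (S₁ ∩ S₂).Nonempty)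

instance isProbabilityMeasure_syncLaw (α : S₁ × S₂) :
    IsProbabilityMeasure (syncLaw P₁ P₂ hQ α) := by
  have := isMarkovKernel_elemKernel P₁ P₂ hQ
  have := isProbabilityMeasure_elemLaw P₁ P₂ hQ α
  exact Measure.isProbabilityMeasure_map measurable_elemConcat.aemeasurable

/-- Decomposition of the synchronization according to the first elementary trajectory. -/
theorem syncLaw_apply (α : S₁ × S₂) {A : Set (Omega S₁ S₂)} (hA : MeasurableSet A) :
    syncLaw P₁ P₂ hQ α A =
      ∑' e : Elem S₁ S₂, elemLaw P₁ P₂ α {e} * syncLaw P₁ P₂ hQ e.last (concat e.traj ⁻¹' A) := by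
  have := isMarkovKernel_elemKernel P₁ P₂ hQ
  have := isProbabilityMeasure_elemLaw P₁ P₂ hQ α
  rw [syncLaw, Measure.map_apply measurable_elemConcat hA, chainLaw_eq_sum,
    Measure.sum_apply _ (measurable_elemConcat hA)]
  refine tsum_congr fun e => ?_
  rw [Measure.smul_apply, smul_eq_mul,
    Measure.map_apply (measurable_appendSeq _) (measurable_elemConcat hA), syncLaw,
    Measure.map_apply measurable_elemConcat (measurable_concat _ hA)]
  congr 2
  ext τ
  simp [elemConcat_appendSeq]

/-- Only the term of `e` survives in the decomposition: two elementary trajectories that are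
prefixes of the same point of `Ω` coincide. -/
theorem syncLaw_cyl_elem_append (α : S₁ × S₂) (e : Elem S₁ S₂) (t : FinTraj S₁ S₂) :
    syncLaw P₁ P₂ hQ α (cyl (e.traj.append t)) =
      elemLaw P₁ P₂ α {e} * syncLaw P₁ P₂ hQ e.last (cyl t) := by
  rw [syncLaw_apply P₁ P₂ hQ α (measurableSet_cyl _), tsum_eq_single e,
    preimage_concat_cyl_append]
  intro e' he'
  have : concat e'.traj ⁻¹' cyl (e.traj.append t) = ∅ := by
    by_contra hne
    obtain ⟨ω, hω⟩ := Set.nonempty_iff_ne_empty.2 hne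
    obtain ⟨v, h1, h2⟩ := e.endsAt
    obtain ⟨v', h1', h2'⟩ := e'.endsAt
    have hω1 := cyl_append_subset _ _ hω
    have hω2 := concat_mem_cyl e'.traj ω
    exact he' (Elem.ext (FinTraj.ext (h1'.eq_of_isPre h1 hω2.1 hω1.1)
      (h2'.eq_of_isPre h2 hω2.2 hω1.2)))
  rw [this, measure_empty, mul_zero]

/-- The finite trajectory `s` satisfies the chain rule
`P_α(↑(s · t)) = P_α(↑s) P_{γ_α(s)}(↑t)` for all `α` and `t`. -/
def ChainRule (s : FinTraj S₁ S₂) : Prop :=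
  ∀ (α : S₁ × S₂) (t : FinTraj S₁ S₂), syncLaw P₁ P₂ hQ α (cyl (s.append t)) =
    syncLaw P₁ P₂ hQ α (cyl s) * syncLaw P₁ P₂ hQ (gam α s) (cyl t)

variable {P₁ P₂ hQ}

/-- The empty `t` identifies the constant, because the law started at `gam α s` has total mass one.
-/
theorem ChainRule.of_exists_const {s : FinTraj S₁ S₂}
    (h : ∀ α, ∃ c, ∀ t, syncLaw P₁ P₂ hQ α (cyl (s.append t)) =
      c * syncLaw P₁ P₂ hQ (gam α s) (cyl t)) : ChainRule P₁ P₂ hQ s := by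
  intro α t
  obtain ⟨c, hc⟩ := h α
  have h1 := hc .nil
  rw [FinTraj.append_nil, cyl_nil, measure_univ, mul_one] at h1
  rw [hc, h1]

theorem ChainRule.append {s t : FinTraj S₁ S₂} (hs : ChainRule P₁ P₂ hQ s)
    (ht : ChainRule P₁ P₂ hQ t) : ChainRule P₁ P₂ hQ (s.append t) := by
  intro α u
  rw [FinTraj.append_assoc, hs α (t.append u), ht, hs α t, gam_append, mul_assoc]

variable (P₁ P₂ hQ)

theorem chainRule_elem (e : Elem S₁ S₂) : ChainRule P₁ P₂ hQ e.traj :=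
  .of_exists_const fun α => ⟨elemLaw P₁ P₂ α {e}, fun t => by
    rw [syncLaw_cyl_elem_append, Elem.gam_traj]⟩

theorem chainRule_of_qList_eq_nil (r : FinTraj S₁ S₂) (hr : qList (S₁ ∩ S₂) r.fst = []) :
    ChainRule P₁ P₂ hQ r := by
  refine .of_exists_const fun α => ?_
  obtain ⟨c, hc⟩ := exists_elemLaw_prepend P₁ P₂ hQ α r hr
  refine ⟨c, fun t => ?_⟩
  rw [syncLaw_apply P₁ P₂ hQ α (measurableSet_cyl _),
    syncLaw_apply P₁ P₂ hQ (gam α r) (measurableSet_cyl _), ← ENNReal.tsum_mul_left,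
    -- The sum for `α` is reindexed by `e ↦ r · e`; the second goal is that terms outside this range
    -- vanish.
    ← (Elem.prepend_injective r hr).tsum_eq]
  · refine tsum_congr fun e => ?_
    have : concat (e.prepend r hr).traj ⁻¹' cyl (r.append t) = concat e.traj ⁻¹' cyl t := by
      ext ω
      simp only [Set.mem_preimage, Elem.prepend, concat_append, concat_mem_cyl_append]
    rw [hc, Elem.last_prepend, this, mul_assoc]
  · intro e he
    have hne : (concat e.traj ⁻¹' cyl (r.append t)).Nonempty := by
      rw [Set.nonempty_iff_ne_empty]
      intro h0
      rw [Function.mem_support, h0, measure_empty, mul_zero] at he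
      exact he rfl
    obtain ⟨ω, hω⟩ := hne
    obtain ⟨v, h1, h2⟩ := e.endsAt
    have hω1 := cyl_append_subset _ _ hω
    have hω2 := concat_mem_cyl e.traj ω
    obtain ⟨l, hl, hlv⟩ := EndsAt.exists_append_of_isPre hr h1 hω1.1 hω2.1
    obtain ⟨m, hm, hmv⟩ := EndsAt.exists_append_of_isPre (r.sync ▸ hr) h2 hω1.2 hω2.2
    exact ⟨Elem.mk' l m v hlv hmv, Elem.ext (FinTraj.ext hl.symm hm.symm)⟩

/-- Induction on the `Q`-sequence: cutting both components just after their first shared state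
splits off an elementary trajectory. -/
theorem chainRule (s : FinTraj S₁ S₂) : ChainRule P₁ P₂ hQ s := by
  induction h : qList (S₁ ∩ S₂) s.fst generalizing s with
  | nil => exact chainRule_of_qList_eq_nil P₁ P₂ hQ s h
  | cons v q ih =>
    obtain ⟨a, b, hab, ha, hb⟩ := exists_endsAt_append h
    obtain ⟨a', b', hab', ha', hb'⟩ := exists_endsAt_append (s.sync ▸ h)
    have hs : s = (Elem.mk' a a' v ha ha').traj.append ⟨b, b', hb.trans hb'.symm⟩ :=
      FinTraj.ext hab hab'
    rw [hs]
    exact (chainRule_elem P₁ P₂ hQ _).append (ih _ hb)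

theorem future_syncLaw (α : S₁ × S₂) (s : FinTraj S₁ S₂)
    (h : 0 < syncLaw P₁ P₂ hQ α (cyl s)) :
    future (syncLaw P₁ P₂ hQ α) s = syncLaw P₁ P₂ hQ (gam α s) := by
  have hcyl : ∀ t, future (syncLaw P₁ P₂ hQ α) s (cyl t) =
      syncLaw P₁ P₂ hQ (gam α s) (cyl t) := by
    intro t
    rw [future, Measure.comap_apply _ (concat_injective s)
      (fun A hA => measurableSet_image_concat s hA) _ (measurableSet_cyl t), image_concat_cyl,
      cond_apply (measurableSet_cyl s), Set.inter_eq_right.2 (cyl_append_subset s t),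
      chainRule P₁ P₂ hQ s α t, ← mul_assoc,
      ENNReal.inv_mul_cancel h.ne' (measure_ne_top _ _), one_mul]
  have huniv : future (syncLaw P₁ P₂ hQ α) s Set.univ = syncLaw P₁ P₂ hQ (gam α s) Set.univ := by
    rw [← cyl_nil, hcyl]
  -- The equality is reversed because finiteness is known beforehand for `syncLaw`, not for
  -- `future`.
  refine (ext_of_generate_finite _ rfl isPiSystem_cyl ?_ huniv.symm).symm
  rintro _ ⟨t, rfl⟩
  exact (hcyl t).symm

/-- If both components are nonempty and end in shared states, these are the last terms of one common
`Q`-sequence. If only one is empty, the other cannot end in a shared state; if both are, the state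
is still `α`. -/
theorem gam_mem_syncStates {α : S₁ × S₂} (hα : α ∈ syncStates S₁ S₂) (s : FinTraj S₁ S₂) :
    gam α s ∈ syncStates S₁ S₂ := by
  have hq : ∀ {S : Finset V} (l : List S) (x : S), (x : V) ∈ S₁ ∩ S₂ →
      qList (S₁ ∩ S₂) (l ++ [x]) = qList (S₁ ∩ S₂) l ++ [(x : V)] := by
    intro S l x hx
    have hx' := Finset.mem_inter.1 hx
    simp [qList, hx'.1, hx'.2]
  rintro ⟨h1, h2⟩
  have hs := s.sync
  rcases List.eq_nil_or_concat s.fst with hl | ⟨l, x, hl⟩ <;>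
    rcases List.eq_nil_or_concat s.snd with hm | ⟨m, y, hm⟩ <;>
    simp only [gam, hl, hm, List.concat_eq_append, List.getLastD_concat, List.getLastD_nil]
      at h1 h2 hs ⊢
  · exact hα ⟨h1, h2⟩
  · rw [hq _ _ h2] at hs
    simp [qList] at hs
  · rw [hq _ _ h1] at hs
    simp [qList] at hs
  · rw [hq _ _ h1, hq _ _ h2] at hs
    simpa using (List.append_inj' hs rfl).2

theorem isMarkovProcess_sync : IsMarkovProcess (syncStates S₁ S₂) (sync P₁ P₂ hQ) where
  prob α := isProbabilityMeasure_syncLaw P₁ P₂ hQ α.1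
  reach α s _ := gam_mem_syncStates α.2 s
  markov α s h := future_syncLaw P₁ P₂ hQ α.1 s h

/-- Pulled back to sequences of elementary trajectories, the property holds for every sequence. -/
theorem isClosedProcess_sync : IsClosedProcess (syncStates S₁ S₂) (sync P₁ P₂ hQ) := by
  intro α
  rw [sync, syncLaw, ae_map_iff measurable_elemConcat.aemeasurable measurableSet_infinite_qSequence]
  exact ae_of_all _ exists_isQTerm_elemConcat

end SyncLaw

end TwoComp

end

theorem mainTheorem1 {V : Type*} [DecidableEq V] (S₁ S₂ : Finset V)
    (hQ : (S₁ ∩ S₂).Nonempty)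
    (hpriv₁ : (S₁ \ (S₁ ∩ S₂)).Nonempty) (hpriv₂ : (S₂ \ (S₁ ∩ S₂)).Nonempty)
    (P₁ : TwoComp.PosTransition S₁) (P₂ : TwoComp.PosTransition S₂) :
    TwoComp.IsMarkovProcess (TwoComp.syncStates S₁ S₂) (TwoComp.sync P₁ P₂ hQ) ∧
      TwoComp.IsClosedProcess (TwoComp.syncStates S₁ S₂) (TwoComp.sync P₁ P₂ hQ) :=
  ⟨TwoComp.isMarkovProcess_sync P₁ P₂ hQ, TwoComp.isClosedProcess_sync P₁ P₂ hQ⟩
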